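/- **Model.** There are $P\ge 1$ processors. Each processor owns finitely many (possibly zero) serial tasks of positive integer sizes, arranged as the leaves of a binary tree in which at every fork the numbers of tasks on the two branches differ by at most one. The span is $T_\infty=\lceil\lg P\rceil+(\text{maximal height of the }P\text{ trees})+(\text{largest task size})$, where $\lg=\log_2$. Initially each processor holds its own tree. In each timestep a busy processor does one unit of work: it expands a fork, continuing with the left branch and putting the right one on the bottom of its deque, or it does one unit of its current serial task and, if that completes the task, pops the bottom of its deque. As long as some work is left, every free processor makes exactly one steal attempt per timestep, and all targets are chosen independently. If the free processor's list is nonempty, the target is uniform on this list (a steal-back); otherwise it is uniform on the processors that have work (a general steal). A steal takes the top of the target's deque; it fails if the deque is empty. If several thieves contend for the same processor, an arbitrary rule (which may depend on the whole past and on the current choices) decides which one succeeds. The stealer of another processor's work is added to the list of the owner of that work, and a processor is removed from an owner's list when a steal-back shows that it holds none of the owner's work any more. **Even distribution of free agents.** When $k$ processors still have unfinished work of their own, at most $\lceil (P-k)/k\rceil$ other processors are working on the work of any one of them. **Theorem 1.** There is an absolute constant $C>0$ such that the following holds for every such computation and every contention rule. Let $N$ be the number of steal attempts (general steals and steal-backs,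 successful or not) made as long as the even distribution of free agents has never failed; thus $N$ is the total number of steal attempts of the execution whenever the even distribution of free agents holds throughout it. Then, for every $0<\epsilon\le 1$, $$\Pr\bigl[N\le C\,P\lg P\,(T_\infty+\lg(P/\epsilon))\bigr]\ge 1-\epsilon ,\qquad\text{and}\qquad \mathbb E[N]\le C\,P\lg P\;T_\infty .$$ In particular, if the even distribution of free agents holds throughout the execution with probability one, both bounds hold for the total number of steal attempts. -/

import Mathlib

open scoped ENNReal

namespace LocalizedStealing

/-- A binary tree whose leaves are serial tasks, each labelled by its size
(the number of timesteps it takes). -/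
inductive WorkTree : Type
  | task (size : ℕ) : WorkTree
  | fork (left right : WorkTree) : WorkTree

namespace WorkTree

/-- Number of serial tasks in the tree. -/
def numTasks : WorkTree → ℕ
  | task _ => 1
  | fork l r => l.numTasks + r.numTasks

/-- Height of the tree, not counting the sizes of the serial tasks. -/
def height : WorkTree → ℕ
  | task _ => 0
  | fork l r => max l.height r.height + 1

/-- Size of the largest serial task. -/
def maxSize : WorkTree → ℕ
  | task n => n
  | fork l r => max l.maxSize r.maxSize

/-- Every serial task has positive size. -/
def PosSizes : WorkTree → Prop
  | task n => 0 < n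
  | fork l r => l.PosSizes ∧ r.PosSizes

/-- At every fork the numbers of serial tasks on the two branches differ by at most one. -/
def Balanced : WorkTree → Prop
  | task _ => True
  | fork l r => l.numTasks ≤ r.numTasks + 1 ∧ r.numTasks ≤ l.numTasks + 1 ∧
      l.Balanced ∧ r.Balanced

end WorkTree

/-- What a busy processor is holding: the owner of all the work it holds, the subtree it is
currently working on, and the deque of pending branches. The head of `deque` is its bottom
(the most recently forked branch, where the processor itself resumes) and the last element
is its top (the branch nearest to the root, which thieves take). -/
structure Job (P : ℕ) where
  owner : Fin P
  current : WorkTree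
  deque : List WorkTree

/-- One timestep of work. Expanding a fork takes one timestep: the processor continues with the
left branch and leaves the right one on the deque. Otherwise one unit of the current serial task
is done; when that completes the task, the processor pops the bottom of its deque, and it becomes
free if the deque is empty. -/
def Job.work {P : ℕ} (J : Job P) : Option (Job P) :=
  match J.current with
  | .fork l r => some ⟨J.owner, l, r :: J.deque⟩
  | .task n =>
    if 2 ≤ n then some ⟨J.owner, .task (n - 1), J.deque⟩
    else
      match J.deque with
      | [] => none
      | t :: d => some ⟨J.owner, t, d⟩

/-- A state of the computation: what each processor holds (`none` if it is free), and, for each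
processor, its list of the other processors that may be working on its work. -/
structure State (P : ℕ) where
  job : Fin P → Option (Job P)
  list : Fin P → Finset (Fin P)

/-- A draw records, for each processor, the target of its steal attempt in the current timestep
(`none` if it makes no steal attempt). -/
abbrev Draw (P : ℕ) : Type := Fin P → Option (Fin P)

namespace State

variable {P : ℕ}

/-- Initially each processor holds its own tree (`none` if it owns no serial task), and all lists
are empty. -/
def init (tree : Fin P → Option WorkTree) : State P where
  job i := (tree i).map fun t => ⟨i, t, []⟩
  list _ := ∅

/-- The owner of the work held by processor `j`, if any. -/
def ownerAt (s : State P) (j : Fin P) : Option (Fin P) := (s.job j).map Job.owner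

/-- The processors that hold work. -/
def busy (s : State P) : Finset (Fin P) := Finset.univ.filter fun j => (s.job j).isSome

/-- The processors that make a steal attempt: as long as some work is left, every free processor
makes exactly one steal attempt per timestep. -/
def thieves (s : State P) : Finset (Fin P) :=
  Finset.univ.filter fun i => s.busy.Nonempty ∧ (s.job i).isNone

/-- The possible targets of a thief `i`: its list if that is nonempty (a steal-back), and all the
processors that have work otherwise (a general steal). -/
def candidates (s : State P) (i : Fin P) : Finset (Fin P) :=
  if (s.list i).Nonempty then s.list i else s.busy

/-- The possible values of the draw of processor `i`. -/
def options (s : State P) (i : Fin P) : Finset (Option (Fin P)) :=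
  if i ∈ s.thieves then (s.candidates i).map Function.Embedding.some else {none}

theorem options_nonempty (s : State P) :
    (Fintype.piFinset s.options).Nonempty := by
  rw [Fintype.piFinset_nonempty]
  intro i
  unfold options
  split_ifs with h
  · rw [Finset.map_nonempty]
    unfold candidates
    split_ifs with h'
    · exact h'
    · simp only [thieves, Finset.mem_filter] at h
      exact h.2.1
  · exact Finset.singleton_nonempty none

/-- The thieves choose their targets independently and uniformly at random: the uniform
distribution on the product of the sets of possible values. -/
noncomputable def drawLaw (s : State P) : PMF (Draw P) :=
  PMF.uniformOfFinset (Fintype.piFinset s.options) s.options_nonempty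

/-- The thieves competing for the top of the deque of processor `j`: those that chose `j` as target
of a general steal, or of a steal-back while `j` is indeed holding work of the thief. -/
def contenders (s : State P) (v : Draw P) (j : Fin P) : Finset (Fin P) :=
  Finset.univ.filter fun i => v i = some j ∧ (s.list i = ∅ ∨ s.ownerAt j = some i)

/-- What the thief `i` obtains, when `pick j A` is the processor that wins the contention for
processor `j` among the contenders `A`: the winner takes the top of the deque, if the deque is
nonempty. -/
def loot (s : State P) (pick : Fin P → Finset (Fin P) → Fin P) (v : Draw P) (i : Fin P) :
    Option (Job P) := do
  let j ← v i
  let J ← s.job j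
  if i ∈ s.contenders v j ∧ pick j (s.contenders v j) = i then
    let t ← J.deque.getLast?
    return ⟨J.owner, t, []⟩
  else none

/-- One timestep. The thieves act on the deques as they are at the beginning of the timestep; every
processor that was busy at the beginning of the timestep loses the top of its deque if somebody
stole it, and then does one timestep of work. A processor removes from its list the target of a
steal-back that turned out to hold none of its work any more; a thief that stole work
of another processor is added to the list of the owner of that work. -/
def step (s : State P) (pick : Fin P → Finset (Fin P) → Fin P) (v : Draw P) : State P where
  job i :=
    match s.job i with
    | some J =>
      if (s.contenders v i).Nonempty then Job.work ⟨J.owner, J.current, J.deque.dropLast⟩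
      else J.work
    | none => s.loot pick v i
  list i :=
    (s.list i).filter (fun j => ¬ (v i = some j ∧ s.ownerAt j ≠ some i)) ∪
      Finset.univ.filter fun g => g ≠ i ∧ (s.loot pick v g).map Job.owner = some i

/-- The owners left: the processors whose own work is not finished. -/
def ownersLeft (s : State P) : Finset (Fin P) :=
  Finset.univ.filter fun i => ∃ j, s.ownerAt j = some i

/-- The processors other than `i` that are working on the work of `i`. -/
def helpers (s : State P) (i : Fin P) : Finset (Fin P) :=
  Finset.univ.filter fun j => j ≠ i ∧ s.ownerAt j = some i

/-- Even distribution of free agents: when there are `k` owners left, the other processors working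
on the work of any given owner are at most `(P - k) / k` in number, rounded up (so that each owner
has at most `P / k` processors, rounded up, working on its work). -/
def EvenlyDistributed (s : State P) : Prop :=
  ∀ i ∈ s.ownersLeft,
    (s.helpers i).card ≤ ⌈((P : ℝ) - s.ownersLeft.card) / s.ownersLeft.card⌉₊

end State

/-- An arbitrary rule for resolving contention: given the draws of all earlier timesteps (latest
first), the current draw, the contested processor and the set of contenders, it names the contender
that succeeds. -/
structure ContentionRule (P : ℕ) where
  pick : List (Draw P) → Draw P → Fin P → Finset (Fin P) → Fin P
  pick_mem : ∀ h v j A, A.Nonempty → pick h v j A ∈ A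

section Execution

variable {P : ℕ} (rule : ContentionRule P) (tree : Fin P → Option WorkTree)

/-- The state reached after a history of draws (latest first). -/
def stateAt : List (Draw P) → State P
  | [] => State.init tree
  | v :: h => (stateAt h).step (rule.pick h v) v

/-- The law of the history of the first `n` timesteps of the localized work-stealing algorithm. -/
noncomputable def historyLaw : ℕ → PMF (List (Draw P))
  | 0 => PMF.pure []
  | n + 1 => (historyLaw n).bind fun h => (stateAt rule tree h).drawLaw.map fun v => v :: h

/-- The number of steal attempts (general steals and steal-backs, successful or not) made during
a history. -/
def stealAttempts : List (Draw P) → ℕ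
  | [] => 0
  | _ :: h => stealAttempts h + (stateAt rule tree h).thieves.card

/-- The even distribution of free agents assumption holds at every moment of a history. -/
def EvenThroughout : List (Draw P) → Prop
  | [] => (stateAt rule tree []).EvenlyDistributed
  | v :: h => EvenThroughout h ∧ (stateAt rule tree (v :: h)).EvenlyDistributed

open Classical in
/-- The number of steal attempts made during a history as long as the even distribution of
free agents assumption has never failed. -/
noncomputable def stealAttemptsWhileEven : List (Draw P) → ℕ
  | [] => 0
  | _ :: h => stealAttemptsWhileEven h +
      if EvenThroughout rule tree h then (stateAt rule tree h).thieves.card else 0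

/-- If the assumption holds throughout a history, then all its steal attempts are counted. -/
theorem stealAttemptsWhileEven_eq (h : List (Draw P)) (hh : EvenThroughout rule tree h) :
    stealAttemptsWhileEven rule tree h = stealAttempts rule tree h := by
  induction h with
  | nil => rfl
  | cons v h ih =>
    simp only [stealAttemptsWhileEven, stealAttempts, ih hh.1, if_pos hh.1]

end Execution

/-- The span: the height of the tree obtained by joining the `P` trees through a binary tree of
height `⌈lg P⌉`, plus the size of the largest serial task. -/
def span {P : ℕ} (tree : Fin P → Option WorkTree) : ℕ :=
  Nat.clog 2 P + (Finset.univ.sup fun i => ((tree i).map WorkTree.height).getD 0) +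
    Finset.univ.sup fun i => ((tree i).map WorkTree.maxSize).getD 0

end LocalizedStealing

/-! Pending work gets a potential exponential in its remaining depth, built so that work never
raises it and a processor whose deque is contended for loses at least a quarter of what it holds,
whether or not a steal succeeds (`Job.pot_hit`). Let Φ be the total potential and φ_i the part owned
by i. Steal attempts are of three kinds.

General: if G of them are made in a timestep, each busy processor is hit with probability at least
G/(2P), so Φ shrinks on average (`State.sum_totalPot_step_le`). Stale (a steal-back finding none of
the owner's work): each one deletes a list entry, and only general steals create entries, so stale
attempts never outnumber general ones. Live (a steal-back finding such work): with k owners left,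
the work of i sits on at most P/k helpers, all of them on its list, so a uniformly chosen helper
carries on average at least a k/P share of φ_i. A live steal-back therefore gets weight k/P
(`State.sum_pot_step_le`).

Consequently Y = exp(G/(16P))(Φ+1) + Σ_i exp(W_i/8)(φ_i+1), with G the general attempts so far and
W_i the live weight of i, is a supermartingale with initial value at most 4P·9^T∞, and log Y
controls G and every W_i.

The factor lg P comes from a pathwise argument turning weights into counts: k only decreases, so an
owner finishing while k are left has made at most P·W_i/k live steal-backs, and the sum over owners
is harmonic (`sum_liveCount_le`). This gives N ≤ 48 P lg P · log Y on every possible history.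
Markov's inequality for Y yields the tail, and a tangent-line bound for log yields the expectation.
-/

namespace LocalizedStealing

/-! ### Potential of trees, deques and jobs. -/

namespace WorkTree

/-- The number of timesteps on the longest path from the root of the tree. -/
def depth : WorkTree → ℕ
  | task n => n
  | fork l r => max l.depth r.depth + 1

theorem depth_le (t : WorkTree) : t.depth ≤ t.height + t.maxSize := by
  induction t with
  | task n => simp [depth, height, maxSize]
  | fork l r hl hr => simp only [depth, height, maxSize]; omega

end WorkTree

/-- The potential of a deque. The entries get weights that strictly increase from the bottom to the
top, start from at least `w`, and are at least the depths of the entries. -/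
def dequePot : ℕ → List WorkTree → ℕ
  | _, [] => 0
  | w, t :: d => 3 * 9 ^ max t.depth w + dequePot (max t.depth w + 1) d

/-- Weights are recomputed from the deque alone, without remembering the forks that produced its
entries. This is harmless because a shallower current subtree can only lower them. -/
theorem dequePot_mono (d : List WorkTree) {w w' : ℕ} (h : w ≤ w') :
    dequePot w d ≤ dequePot w' d := by
  induction d generalizing w w' with
  | nil => simp [dequePot]
  | cons t d ih =>
    have h1 : max t.depth w ≤ max t.depth w' := by omega
    have h2 : 9 ^ max t.depth w ≤ 9 ^ max t.depth w' := Nat.pow_le_pow_right (by norm_num) h1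
    have h3 := ih (Nat.succ_le_succ h1)
    simp only [dequePot]
    simp only [Nat.succ_eq_add_one] at h3
    omega

/-- The top entry dominates the potential of a deque. -/
theorem dequePot_concat (d : List WorkTree) (t : WorkTree) (w : ℕ) :
    ∃ W, t.depth ≤ W ∧ w ≤ W ∧ dequePot w (d ++ [t]) = dequePot w d + 3 * 9 ^ W ∧
      8 * dequePot w d + 3 * 9 ^ w ≤ 3 * 9 ^ W := by
  induction d generalizing w with
  | nil =>
    refine ⟨max t.depth w, le_max_left _ _, le_max_right _ _, by simp [dequePot], ?_⟩
    have : 9 ^ w ≤ 9 ^ max t.depth w := Nat.pow_le_pow_right (by norm_num) (le_max_right _ _)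
    simp only [dequePot]; omega
  | cons x e ih =>
    obtain ⟨W, h1, h2, h3, h4⟩ := ih (max x.depth w + 1)
    have h5 : 9 ^ w ≤ 9 ^ max x.depth w := Nat.pow_le_pow_right (by norm_num) (le_max_right _ _)
    refine ⟨W, h1, by omega, ?_, ?_⟩
    · simp only [List.cons_append, dequePot, h3]; omega
    · rw [pow_succ] at h4
      simp only [dequePot]; omega

/-- The potential of a job. -/
def Job.pot {P : ℕ} (J : Job P) : ℕ := 9 ^ J.current.depth + dequePot J.current.depth J.deque

theorem Job.pot_pos {P : ℕ} (J : Job P) : 0 < J.pot := by unfold Job.pot; positivity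

/-- The potential of the work of `i` held by a processor. -/
def optPot {P : ℕ} (i : Fin P) : Option (Job P) → ℕ
  | none => 0
  | some J => if J.owner = i then J.pot else 0

@[simp] theorem optPot_none {P : ℕ} (i : Fin P) : optPot i none = 0 := rfl

theorem optPot_some {P : ℕ} (i : Fin P) (J : Job P) :
    optPot i (some J) = if J.owner = i then J.pot else 0 := rfl

theorem Job.work_owner {P : ℕ} {J K : Job P} (h : J.work = some K) : K.owner = J.owner := by
  unfold Job.work at h
  split at h
  · cases h; rfl
  · split at h
    · cases h; rfl
    · split at h
      · cases h
      · cases h; rfl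

/-- A timestep of work destroys half of the potential of the current subtree. -/
theorem Job.pot_work {P : ℕ} (J : Job P) :
    2 * optPot J.owner J.work + 9 ^ J.current.depth ≤ 2 * J.pot := by
  obtain ⟨o, c, d⟩ := J
  cases c with
  | fork l r =>
    -- The constants 9 and 3 are tuned here. With M the larger branch depth, the fork's 9·9^M
    -- becomes at most 9^M + 3·9^M, and 2·4 + 9 ≤ 2·9.
    have h1 : 9 ^ l.depth ≤ 9 ^ max l.depth r.depth :=
      Nat.pow_le_pow_right (by norm_num) (le_max_left _ _)
    have h2 : max r.depth l.depth = max l.depth r.depth := max_comm _ _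
    simp only [Job.work, optPot, Job.pot, WorkTree.depth, dequePot, h2, if_true, pow_succ]
    omega
  | task n =>
    by_cases hn : 2 ≤ n
    · obtain ⟨m, rfl⟩ : ∃ m, n = m + 1 := ⟨n - 1, by omega⟩
      have := dequePot_mono d (Nat.le_succ m)
      simp only [Job.work, optPot, Job.pot, WorkTree.depth, if_pos hn, if_true, pow_succ,
        Nat.add_sub_cancel]
      simp only [Nat.succ_eq_add_one] at this
      omega
    · cases d with
      | nil => simp [Job.work, optPot, Job.pot, WorkTree.depth, hn, dequePot]
      | cons t d =>
        have h1 : 9 ^ t.depth ≤ 9 ^ max t.depth n :=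
          Nat.pow_le_pow_right (by norm_num) (le_max_left _ _)
        have h2 : dequePot t.depth d ≤ dequePot (max t.depth n + 1) d := dequePot_mono d (by omega)
        have h3 : 0 < 9 ^ n := by positivity
        simp only [Job.work, optPot, Job.pot, WorkTree.depth, if_neg hn, if_true, dequePot]
        omega

/-- The potential of the top of a deque as the current subtree of the thief that takes it. -/
def topPot (d : List WorkTree) : ℕ := (d.getLast?.map fun t => 9 ^ t.depth).getD 0

/-- A timestep in which somebody targets the deque destroys a quarter of the potential. -/
theorem Job.pot_hit {P : ℕ} (J : Job P) :
    4 * (optPot J.owner (Job.work ⟨J.owner, J.current, J.deque.dropLast⟩) + topPot J.deque)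
      ≤ 3 * J.pot := by
  have hw := Job.pot_work (⟨J.owner, J.current, J.deque.dropLast⟩ : Job P)
  obtain ⟨o, c, d⟩ := J
  rcases List.eq_nil_or_concat d with rfl | ⟨e, t, rfl⟩
  -- With an empty deque the current subtree is the whole potential, and the timestep of work alone
  -- halves it.
  · simp [topPot, Job.pot, dequePot] at hw ⊢
    omega
  -- The stolen top drops from 3·9^W to at most 9^W, because it becomes a current subtree. It
  -- dominates the rest of the deque, so this is a constant fraction of the whole.
  · obtain ⟨W, h1, h2, h3, h4⟩ := dequePot_concat e t c.depth
    have h5 : 9 ^ t.depth ≤ 9 ^ W := Nat.pow_le_pow_right (by norm_num) h1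
    have h6 : 9 ^ c.depth ≤ 9 ^ W := Nat.pow_le_pow_right (by norm_num) h2
    simp [topPot, Job.pot, h3] at hw ⊢
    omega

/-! ### One timestep: loss of potential, owners and lists. -/

namespace State

variable {P : ℕ} (s : State P)

/-- The potential of the work of `i`. -/
def pot (i : Fin P) : ℕ := ∑ j, optPot i (s.job j)

theorem loot_some {pick : Fin P → Finset (Fin P) → Fin P} {v : Draw P} {g : Fin P} {K : Job P}
    (h : s.loot pick v g = some K) :
    ∃ j J t, v g = some j ∧ s.job j = some J ∧ g ∈ s.contenders v j ∧
      pick j (s.contenders v j) = g ∧ J.deque.getLast? = some t ∧ K = ⟨J.owner, t, []⟩ := by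
  unfold loot at h
  rcases hv : v g with _ | j
  · simp [hv] at h
  rcases hJ : s.job j with _ | J
  · simp [hv, hJ] at h
  by_cases hc : g ∈ s.contenders v j ∧ pick j (s.contenders v j) = g
  · rcases ht : J.deque.getLast? with _ | t
    · simp [hv, hJ, ht] at h
    · refine ⟨j, J, t, rfl, hJ, hc.1, hc.2, ht, ?_⟩
      simp [hv, hJ, hc, ht] at h
      exact h.symm
  · simp [hv, hJ, hc] at h

/-- The potential of the work of `i` that is taken from processor `j`. -/
def takenPot (v : Draw P) (i j : Fin P) : ℕ :=
  match s.job j with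
  | none => 0
  | some J => if (s.contenders v j).Nonempty ∧ J.owner = i then topPot J.deque else 0

/-- Loot is charged to its victim. As `pick` names a single winner per victim, summing over thieves
counts each stolen top at most once. -/
theorem optPot_loot_le (pick : Fin P → Finset (Fin P) → Fin P) (v : Draw P) (i g : Fin P) :
    optPot i (s.loot pick v g) ≤
      ∑ j, if pick j (s.contenders v j) = g then s.takenPot v i j else 0 := by
  rcases h : s.loot pick v g with _ | K
  · simp [optPot]
  · obtain ⟨j, J, t, -, hJ, hc, hp, ht, rfl⟩ := s.loot_some h
    refine le_trans ?_ (Finset.single_le_sum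
      (f := fun j => if pick j (s.contenders v j) = g then s.takenPot v i j else 0)
      (fun _ _ => Nat.zero_le _) (Finset.mem_univ j))
    have hne : (s.contenders v j).Nonempty := ⟨g, hc⟩
    simp only [hp, if_true, takenPot, hJ, hne, true_and, optPot, topPot, ht, Job.pot, dequePot,
      Option.map_some, Option.getD_some, add_zero, le_refl]

/-- The work of `j` after a timestep, not counting what thieves took. -/
def worked (v : Draw P) (j : Fin P) : Option (Job P) :=
  match s.job j with
  | none => none
  | some J =>
    if (s.contenders v j).Nonempty then Job.work ⟨J.owner, J.current, J.deque.dropLast⟩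
    else J.work

theorem optPot_work_of_ne {J : Job P} {i : Fin P} (h : J.owner ≠ i) : optPot i J.work = 0 := by
  rcases hK : J.work with _ | K
  · rfl
  · have := Job.work_owner hK
    simp [optPot, this, h]

theorem pot_step (pick : Fin P → Finset (Fin P) → Fin P) (v : Draw P) (i : Fin P) :
    4 * (s.step pick v).pot i +
      ∑ j, (if (s.contenders v j).Nonempty then optPot i (s.job j) else 0) ≤ 4 * s.pot i := by
  have h1 : ∀ g, optPot i ((s.step pick v).job g) ≤ optPot i (s.worked v g) +
      ∑ j, if pick j (s.contenders v j) = g then s.takenPot v i j else 0 := by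
    intro g
    simp only [step, worked]
    rcases hg : s.job g with _ | J
    · simpa [optPot] using s.optPot_loot_le pick v i g
    · simp
  have h2 : (s.step pick v).pot i ≤ ∑ j, (optPot i (s.worked v j) + s.takenPot v i j) := by
    refine (Finset.sum_le_sum fun g _ => h1 g).trans ?_
    rw [Finset.sum_add_distrib, Finset.sum_add_distrib, Finset.sum_comm]
    simp
  have h3 : ∀ j, 4 * (optPot i (s.worked v j) + s.takenPot v i j) +
      (if (s.contenders v j).Nonempty then optPot i (s.job j) else 0)
        ≤ 4 * optPot i (s.job j) := by
    intro j
    rcases hj : s.job j with _ | J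
    · simp [worked, takenPot, hj, optPot]
    · by_cases ho : J.owner = i
      · subst ho
        by_cases hc : (s.contenders v j).Nonempty
        · have := J.pot_hit
          simp only [worked, takenPot, hj, hc, if_true, true_and, optPot_some] at this ⊢
          omega
        · have := J.pot_work
          have hp : 0 < 9 ^ J.current.depth := by positivity
          simp only [worked, takenPot, hj, hc, if_false, false_and, optPot_some, if_true] at this ⊢
          omega
      · have e1 := optPot_work_of_ne ho
        have e2 := optPot_work_of_ne (J := ⟨J.owner, J.current, J.deque.dropLast⟩) ho
        by_cases hc : (s.contenders v j).Nonempty <;>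
          simp [worked, takenPot, hj, hc, ho, optPot_some, e1, e2]
  calc _ ≤ ∑ j, (4 * (optPot i (s.worked v j) + s.takenPot v i j) +
      (if (s.contenders v j).Nonempty then optPot i (s.job j) else 0)) := by
        rw [Finset.sum_add_distrib, ← Finset.mul_sum]; omega
    _ ≤ ∑ j, 4 * optPot i (s.job j) := Finset.sum_le_sum fun j _ => h3 j
    _ = _ := by rw [pot, Finset.mul_sum]

/-- A processor that holds work of `i` after a timestep either held it before, or got it from a
processor that did. -/
theorem ownerAt_step {pick : Fin P → Finset (Fin P) → Fin P} {v : Draw P} {g i : Fin P}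
    (h : (s.step pick v).ownerAt g = some i) :
    s.ownerAt g = some i ∨ (s.job g = none ∧ (s.loot pick v g).map Job.owner = some i) := by
  simp only [ownerAt, step] at h ⊢
  rcases hg : s.job g with _ | J
  · simp only [hg] at h
    exact Or.inr ⟨rfl, h⟩
  · left
    simp only [hg] at h
    split_ifs at h <;>
    · obtain ⟨K, hK, rfl⟩ := Option.map_eq_some_iff.1 h
      simp [Job.work_owner hK]

theorem ownerAt_of_loot {pick : Fin P → Finset (Fin P) → Fin P} {v : Draw P} {g i : Fin P}
    (h : (s.loot pick v g).map Job.owner = some i) : ∃ j, s.ownerAt j = some i ∧ v g = some j ∧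
      g ∈ s.contenders v j := by
  obtain ⟨K, hK, rfl⟩ := Option.map_eq_some_iff.1 h
  obtain ⟨j, J, t, hv, hJ, hc, -, -, rfl⟩ := s.loot_some hK
  exact ⟨j, by simp [ownerAt, hJ], hv, hc⟩

/-- Work of an owner is only handed on, so a finished owner stays finished. -/
theorem ownersLeft_step (pick : Fin P → Finset (Fin P) → Fin P) (v : Draw P) :
    (s.step pick v).ownersLeft ⊆ s.ownersLeft := by
  intro i hi
  simp only [ownersLeft, Finset.mem_filter, Finset.mem_univ, true_and] at hi ⊢
  obtain ⟨g, hg⟩ := hi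
  rcases s.ownerAt_step hg with h | ⟨-, h⟩
  · exact ⟨g, h⟩
  · obtain ⟨j, hj, -⟩ := s.ownerAt_of_loot h
    exact ⟨j, hj⟩

/-- The list of `i` contains every other processor that holds work of `i`. -/
def ListsComplete : Prop := ∀ i, s.helpers i ⊆ s.list i

/-- A removal requires that the target held none of the owner's work at the start of the timestep.
If the target acquires some in that very timestep, it is added back at once. -/
theorem ListsComplete.step {s : State P} (hs : s.ListsComplete)
    (pick : Fin P → Finset (Fin P) → Fin P) (v : Draw P) : (s.step pick v).ListsComplete := by
  intro i g hg
  simp only [helpers, Finset.mem_filter, Finset.mem_univ, true_and] at hg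
  simp only [State.step, Finset.mem_union, Finset.mem_filter, Finset.mem_univ, true_and]
  rcases s.ownerAt_step hg.2 with h | ⟨-, h⟩
  · left
    refine ⟨hs i ?_, fun h' => h'.2 h⟩
    simp [helpers, hg.1, h]
  · exact Or.inr ⟨hg.1, h⟩

/-- The processors that make a general steal attempt. -/
def generals : Finset (Fin P) := s.thieves.filter fun i => s.list i = ∅

/-- The steal-back of `i` finds work of `i`. -/
def Live (v : Draw P) (i : Fin P) : Prop := ∃ j, v i = some j ∧ s.ownerAt j = some i

open Classical in
/-- The processors whose steal-back finds that the target holds none of their work. -/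
noncomputable def stales (v : Draw P) : Finset (Fin P) :=
  s.thieves.filter fun i => (s.list i).Nonempty ∧ ¬ s.Live v i

open Classical in
theorem card_thieves_le (v : Draw P) :
    s.thieves.card ≤ s.generals.card + (s.stales v).card +
      (Finset.univ.filter fun i => s.Live v i).card := by
  refine le_trans (Finset.card_le_card (t := s.generals ∪ s.stales v ∪
    Finset.univ.filter fun i => s.Live v i) ?_) ((Finset.card_union_le _ _).trans
      (Nat.add_le_add_right (Finset.card_union_le _ _) _))
  intro i hi
  simp only [Finset.mem_union, generals, stales, Finset.mem_filter, hi, true_and, Finset.mem_univ]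
  rcases Finset.eq_empty_or_nonempty (s.list i) with h | h
  · exact Or.inl (Or.inl h)
  · by_cases hl : s.Live v i
    · exact Or.inr hl
    · exact Or.inl (Or.inr ⟨h, hl⟩)

theorem mem_of_mem_options {v : Draw P} (hv : v ∈ Fintype.piFinset s.options) {i j : Fin P}
    (h : v i = some j) : i ∈ s.thieves ∧ j ∈ s.candidates i := by
  have := Fintype.mem_piFinset.1 hv i
  unfold options at this
  split_ifs at this with hi
  · rw [h] at this
    simpa [hi] using this
  · simp [h] at this

theorem exists_of_mem_thieves {v : Draw P} (hv : v ∈ Fintype.piFinset s.options) {i : Fin P}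
    (h : i ∈ s.thieves) : ∃ j, v i = some j := by
  have := Fintype.mem_piFinset.1 hv i
  simp only [options, if_pos h, Finset.mem_map] at this
  obtain ⟨j, -, hj⟩ := this
  exact ⟨j, hj.symm⟩

/-- A stale steal-back shortens a list, and only general steals lengthen lists. -/
theorem card_lists_step (pick : Fin P → Finset (Fin P) → Fin P) {v : Draw P}
    (hv : v ∈ Fintype.piFinset s.options) :
    ∑ i, ((s.step pick v).list i).card + (s.stales v).card ≤
      ∑ i, (s.list i).card + s.generals.card := by
  classical
  set kept : Fin P → Finset (Fin P) := fun i =>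
    (s.list i).filter (fun j => ¬ (v i = some j ∧ s.ownerAt j ≠ some i)) with hkept
  set added : Fin P → Finset (Fin P) := fun i =>
    Finset.univ.filter fun g => g ≠ i ∧ (s.loot pick v g).map Job.owner = some i with hadded
  have h1 : ∀ i, (kept i).card + (if i ∈ s.stales v then 1 else 0) ≤ (s.list i).card := by
    intro i
    split_ifs with hi
    · simp only [stales, Finset.mem_filter] at hi
      obtain ⟨j, hj⟩ := s.exists_of_mem_thieves hv hi.1
      have hc := (s.mem_of_mem_options hv hj).2
      rw [candidates, if_pos hi.2.1] at hc
      refine Finset.card_lt_card (Finset.filter_ssubset.2 ⟨j, hc, ?_⟩)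
      rw [not_not]
      exact ⟨hj, fun h => hi.2.2 ⟨j, hj, h⟩⟩
    · exact Finset.card_filter_le _ _
  -- A winning steal-back takes the thief's own work, which adds nobody because of `g ≠ i`. Hence
  -- every added processor made a general steal, and it appears on one list only, that of the owner
  -- of its loot.
  have h2 : ∑ i, (added i).card ≤ s.generals.card := by
    rw [← Finset.card_biUnion]
    · refine Finset.card_le_card fun g hg => ?_
      simp only [hadded, Finset.mem_biUnion, Finset.mem_filter, Finset.mem_univ, true_and] at hg
      obtain ⟨i, hgi, hi⟩ := hg
      obtain ⟨j, hj, hvg, hc⟩ := s.ownerAt_of_loot hi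
      simp only [generals, Finset.mem_filter]
      refine ⟨(s.mem_of_mem_options hv hvg).1, ?_⟩
      simp only [contenders, Finset.mem_filter, Finset.mem_univ, true_and] at hc
      rcases hc.2 with h | h
      · exact h
      · rw [h] at hj
        exact absurd (Option.some.inj hj) hgi
    · intro i _ i' _ hne
      rw [Function.onFun, Finset.disjoint_left]
      intro g hg hg'
      simp only [hadded, Finset.mem_filter, Finset.mem_univ, true_and] at hg hg'
      exact hne (Option.some.inj (hg.2.symm.trans hg'.2))
  have h3 : ∑ i, ((s.step pick v).list i).card ≤ ∑ i, ((kept i).card + (added i).card) :=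
    Finset.sum_le_sum fun i _ => Finset.card_union_le _ _
  have h4 := Finset.sum_le_sum fun i (_ : i ∈ Finset.univ) => h1 i
  rw [Finset.sum_add_distrib, Finset.sum_boole] at h4
  simp only [Finset.filter_mem_eq_inter, Finset.univ_inter, Nat.cast_id] at h4
  rw [Finset.sum_add_distrib] at h3
  omega

end State


/-! ### Average loss of potential in one timestep. -/

/-- The average over a product of finite sets of a function of one coordinate. -/
theorem sum_piFinset_apply_le {ι α : Type*} [Fintype ι] [DecidableEq ι] [DecidableEq α]
    (S : ι → Finset α) (i : ι) (f : α → ℝ) (c : ℝ) (h : ∑ x ∈ S i, f x ≤ (S i).card * c) :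
    ∑ v ∈ Fintype.piFinset S, f (v i) ≤ (Fintype.piFinset S).card * c := by
  rw [← Finset.sum_fiberwise_of_maps_to' (g := fun v : ι → α => v i) (t := S i)
    (fun v hv => Fintype.mem_piFinset.1 hv i) f]
  have h1 : ∀ x ∈ S i, ∑ v ∈ Fintype.piFinset S with v i = x, f x =
      ((∏ j ∈ Finset.univ.erase i, (S j).card : ℕ) : ℝ) * f x := by
    intro x hx
    rw [Finset.sum_const, nsmul_eq_mul, Fintype.card_filter_piFinset_eq_of_mem _ _ hx]
  rw [Finset.sum_congr rfl h1, ← Finset.mul_sum, Fintype.card_piFinset,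
    ← Finset.mul_prod_erase _ _ (Finset.mem_univ i), Nat.cast_mul, mul_comm ((S i).card : ℝ),
    mul_assoc]
  exact mul_le_mul_of_nonneg_left h (Nat.cast_nonneg _)

theorem exp_neg_le_one_sub_half {y : ℝ} (h0 : 0 ≤ y) (h1 : y ≤ 1) :
    Real.exp (-y) ≤ 1 - y / 2 := by
  have h2 := Real.add_one_le_exp y
  rw [Real.exp_neg, inv_le_iff_one_le_mul₀ (Real.exp_pos y)]
  nlinarith [mul_le_mul_of_nonneg_left h2 (show 0 ≤ 1 - y / 2 by linarith)]

namespace State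

variable {P : ℕ} (s : State P)

/-- The potential of the whole remaining work. -/
def totalPot : ℕ := ∑ i, s.pot i

/-- The potential of what processor `j` holds. -/
def heldPot (j : Fin P) : ℕ := ∑ i, optPot i (s.job j)

theorem totalPot_eq : s.totalPot = ∑ j, s.heldPot j := Finset.sum_comm

theorem totalPot_step (pick : Fin P → Finset (Fin P) → Fin P) (v : Draw P) :
    4 * (s.step pick v).totalPot +
      ∑ j, (if (s.contenders v j).Nonempty then s.heldPot j else 0) ≤ 4 * s.totalPot := by
  have h := Finset.sum_le_sum fun i (_ : i ∈ Finset.univ) => s.pot_step pick v i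
  rw [Finset.sum_add_distrib, ← Finset.mul_sum, ← Finset.mul_sum, Finset.sum_comm] at h
  refine le_trans (Nat.add_le_add_left (Finset.sum_le_sum fun j _ => ?_) _) h
  split_ifs
  · exact le_rfl
  · exact Nat.zero_le _

theorem heldPot_eq_zero {j : Fin P} (h : j ∉ s.busy) : s.heldPot j = 0 := by
  have : s.job j = none := by simpa [busy] using h
  simp [heldPot, this]

theorem totalPot_pos (h : s.busy.Nonempty) : 0 < s.totalPot := by
  obtain ⟨j, hj⟩ := h
  simp only [busy, Finset.mem_filter, Finset.mem_univ, true_and] at hj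
  obtain ⟨J, hJ⟩ := Option.isSome_iff_exists.1 hj
  rw [totalPot_eq]
  refine Finset.sum_pos' (fun _ _ => Nat.zero_le _) ⟨j, Finset.mem_univ _, ?_⟩
  refine Finset.sum_pos' (fun _ _ => Nat.zero_le _) ⟨J.owner, Finset.mem_univ _, ?_⟩
  rw [hJ, optPot_some, if_pos rfl]
  exact J.pot_pos

/-- A processor that has work is targeted with a probability proportional to the number of
general steal attempts. -/
theorem card_hit_ge {j : Fin P} (hj : j ∈ s.busy) :
    ((Fintype.piFinset s.options).card : ℝ) * (s.generals.card / (2 * P)) ≤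
      ((Fintype.piFinset s.options).filter fun v => (s.contenders v j).Nonempty).card := by
  classical
  have hP : 0 < P := Fin.pos j
  have hP' : (0 : ℝ) < P := Nat.cast_pos.2 hP
  have hB : 0 < s.busy.card := Finset.card_pos.2 ⟨j, hj⟩
  have hB' : (0 : ℝ) < s.busy.card := Nat.cast_pos.2 hB
  have hBP : (s.busy.card : ℝ) ≤ P := by
    exact_mod_cast (Finset.card_le_univ _).trans_eq (Fintype.card_fin P)
  have hGP : (s.generals.card : ℝ) ≤ P := by
    exact_mod_cast (Finset.card_le_univ _).trans_eq (Fintype.card_fin P)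
  -- If nobody contends for j, every general thief avoids j. Ignoring steal-backs turns this into a
  -- product set, whose size factorizes by independence.
  set T : Fin P → Finset (Option (Fin P)) := fun i =>
    if i ∈ s.generals then (s.options i).erase (some j) else s.options i with hT
  have h1 : (Fintype.piFinset s.options).filter (fun v => ¬ (s.contenders v j).Nonempty) ⊆
      Fintype.piFinset T := by
    intro v hv
    obtain ⟨hv, hn⟩ := Finset.mem_filter.1 hv
    rw [Fintype.mem_piFinset] at hv ⊢
    intro i
    simp only [hT]
    split_ifs with hi
    · refine Finset.mem_erase.2 ⟨fun h => hn ⟨i, ?_⟩, hv i⟩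
      simp only [contenders, Finset.mem_filter, Finset.mem_univ, true_and]
      exact ⟨h, Or.inl (Finset.mem_filter.1 hi).2⟩
    · exact hv i
  have h2 : ∀ i, ((T i).card : ℝ) =
      (if i ∈ s.generals then 1 - 1 / (s.busy.card : ℝ) else 1) * (s.options i).card := by
    intro i
    simp only [hT]
    split_ifs with hi
    · obtain ⟨ht, hl⟩ := Finset.mem_filter.1 hi
      have ho : s.options i = s.busy.map Function.Embedding.some := by
        simp [options, ht, candidates, hl]
      rw [ho, Finset.card_erase_of_mem (by simpa using hj), Finset.card_map, Nat.cast_sub hB]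
      field_simp
      simp
    · simp
  have h3 : ((Fintype.piFinset T).card : ℝ) =
      (1 - 1 / (s.busy.card : ℝ)) ^ s.generals.card * (Fintype.piFinset s.options).card := by
    rw [Fintype.card_piFinset, Fintype.card_piFinset, Nat.cast_prod, Nat.cast_prod,
      Finset.prod_congr rfl fun i _ => h2 i, Finset.prod_mul_distrib, Finset.prod_ite]
    simp
  -- At most P processors are busy, so the power is at most exp(-G/P). As G ≤ P, the exponential
  -- lies below 1 - G/(2P).
  have h4 : (1 - 1 / (s.busy.card : ℝ)) ^ s.generals.card ≤ 1 - s.generals.card / (2 * P) := by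
    have hb : (0 : ℝ) ≤ 1 - 1 / s.busy.card := by
      rw [sub_nonneg, div_le_one hB']; exact_mod_cast hB
    calc (1 - 1 / (s.busy.card : ℝ)) ^ s.generals.card
        ≤ (Real.exp (-(1 / P))) ^ s.generals.card := by
          refine pow_le_pow_left₀ hb (le_trans ?_ (Real.one_sub_le_exp_neg _)) _
          have : 1 / (P : ℝ) ≤ 1 / s.busy.card := one_div_le_one_div_of_le hB' hBP
          linarith
      _ = Real.exp (-(s.generals.card / P)) := by
          rw [← Real.exp_nat_mul]; congr 1; ring
      _ ≤ 1 - s.generals.card / P / 2 :=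
          exp_neg_le_one_sub_half (by positivity) ((div_le_one hP').2 hGP)
      _ = _ := by ring
  have h5 := Finset.card_filter_add_card_filter_not (s := Fintype.piFinset s.options)
    (fun v => (s.contenders v j).Nonempty)
  have h6 : (((Fintype.piFinset s.options).filter fun v =>
      ¬ (s.contenders v j).Nonempty).card : ℝ) ≤ (Fintype.piFinset T).card := by
    exact_mod_cast Finset.card_le_card h1
  rw [h3] at h6
  have h7 := mul_le_mul_of_nonneg_right h4 (Nat.cast_nonneg (Fintype.piFinset s.options).card)
  have h8 : (((Fintype.piFinset s.options).filter fun v =>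
      (s.contenders v j).Nonempty).card : ℝ) + ((Fintype.piFinset s.options).filter fun v =>
      ¬ (s.contenders v j).Nonempty).card = (Fintype.piFinset s.options).card := by
    exact_mod_cast h5
  linarith

/-- The total potential, weighted by the number of general steal attempts, decreases on average. -/
theorem sum_totalPot_step_le (pick : Draw P → Fin P → Finset (Fin P) → Fin P) :
    ∑ v ∈ Fintype.piFinset s.options, Real.exp (s.generals.card / (16 * P)) *
        (((s.step (pick v) v).totalPot : ℝ) + 1) ≤
      (Fintype.piFinset s.options).card * ((s.totalPot : ℝ) + 1) := by
  set Ω := Fintype.piFinset s.options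
  have hstep : ∀ v, 4 * ((s.step (pick v) v).totalPot : ℝ) +
      ∑ j, (if (s.contenders v j).Nonempty then (s.heldPot j : ℝ) else 0) ≤
        4 * (s.totalPot : ℝ) := fun v => by exact_mod_cast s.totalPot_step (pick v) v
  by_cases hG : s.generals.card = 0
  · rw [hG, ← nsmul_eq_mul]
    refine Finset.sum_le_card_nsmul _ _ _ fun v _ => ?_
    have h := hstep v
    have : 0 ≤ ∑ j, (if (s.contenders v j).Nonempty then (s.heldPot j : ℝ) else 0) :=
      Finset.sum_nonneg fun j _ => by split_ifs <;> positivity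
    rw [Nat.cast_zero, zero_div, Real.exp_zero, one_mul]
    linarith
  have hpos : (1 : ℝ) ≤ s.totalPot := by
    obtain ⟨i, hi⟩ := Finset.card_ne_zero.1 hG
    have := (Finset.mem_filter.1 (Finset.mem_filter.1 hi).1).2.1
    exact_mod_cast s.totalPot_pos this
  have hP : (0 : ℝ) < P := by
    obtain ⟨i, -⟩ := Finset.card_ne_zero.1 hG
    exact Nat.cast_pos.2 (Fin.pos i)
  have h1 : ∑ v ∈ Ω, ∑ j, (if (s.contenders v j).Nonempty then (s.heldPot j : ℝ) else 0) ≥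
      Ω.card * (s.generals.card / (2 * P)) * s.totalPot := by
    rw [Finset.sum_comm, totalPot_eq, Nat.cast_sum, Finset.mul_sum]
    refine Finset.sum_le_sum fun j _ => ?_
    by_cases hj : j ∈ s.busy
    · rw [← Finset.sum_filter, Finset.sum_const, nsmul_eq_mul]
      exact mul_le_mul_of_nonneg_right (s.card_hit_ge hj) (Nat.cast_nonneg _)
    · simp [s.heldPot_eq_zero hj]
  have h2 := Finset.sum_le_sum fun v (_ : v ∈ Ω) => hstep v
  rw [Finset.sum_add_distrib, Finset.sum_const, nsmul_eq_mul, ← Finset.mul_sum] at h2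
  rw [← Finset.mul_sum, Finset.sum_add_distrib, Finset.sum_const, nsmul_eq_mul, mul_one]
  set x : ℝ := s.generals.card / (16 * P) with hx
  have hx0 : 0 ≤ x := by positivity
  have hx8 : (s.generals.card : ℝ) / (2 * P) = 8 * x := by rw [hx]; field_simp; norm_num
  rw [hx8] at h1
  have hc : (0 : ℝ) ≤ Ω.card := Nat.cast_nonneg _
  -- The average loss is at least 2xΦ. Since a thief exists only while work is left, Φ ≥ 1 and 2xΦ ≥
  -- x(Φ + 1).
  have h3 : ∑ v ∈ Ω, ((s.step (pick v) v).totalPot : ℝ) + Ω.card ≤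
      Ω.card * (s.totalPot + 1) * (1 - x) := by
    nlinarith [mul_nonneg (mul_nonneg hc hx0) (sub_nonneg.2 hpos)]
  have h4 : (1 - x) ≤ Real.exp (-x) := Real.one_sub_le_exp_neg x
  calc _ ≤ Real.exp x * (Ω.card * (s.totalPot + 1) * Real.exp (-x)) := by
        refine mul_le_mul_of_nonneg_left (h3.trans ?_) (Real.exp_pos x).le
        exact mul_le_mul_of_nonneg_left h4 (by positivity)
    _ = Ω.card * (s.totalPot + 1) * (Real.exp x * Real.exp (-x)) := by ring
    _ = _ := by rw [← Real.exp_add]; simp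

/-- The rounding costs nothing: ⌈(P-k)/k⌉ < (P-k)/k + 1 = P/k. -/
theorem EvenlyDistributed.card_helpers_mul_le {s : State P} (h : s.EvenlyDistributed) {i : Fin P}
    (hi : i ∈ s.ownersLeft) : ((s.helpers i).card : ℝ) * s.ownersLeft.card ≤ P := by
  have hk : (0 : ℝ) < s.ownersLeft.card := Nat.cast_pos.2 (Finset.card_pos.2 ⟨i, hi⟩)
  have hkP : (s.ownersLeft.card : ℝ) ≤ P := by
    exact_mod_cast (Finset.card_le_univ _).trans_eq (Fintype.card_fin P)
  have h1 : ((s.helpers i).card : ℝ) ≤ ⌈((P : ℝ) - s.ownersLeft.card) / s.ownersLeft.card⌉₊ := by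
    exact_mod_cast h i hi
  have h2 := Nat.ceil_lt_add_one (div_nonneg (sub_nonneg.2 hkP) hk.le)
  have h3 : ((P : ℝ) - s.ownersLeft.card) / s.ownersLeft.card + 1 = P / s.ownersLeft.card := by
    field_simp; ring
  rw [h3] at h2
  exact (le_div_iff₀ hk).1 (h1.trans h2.le)

theorem pot_step_le (pick : Fin P → Finset (Fin P) → Fin P) (v : Draw P) (i : Fin P) :
    ((s.step pick v).pot i : ℝ) ≤ s.pot i := by
  have := s.pot_step pick v i
  exact_mod_cast (show (s.step pick v).pot i ≤ s.pot i by omega)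

theorem pot_step_hit_le (pick : Fin P → Finset (Fin P) → Fin P) {v : Draw P} {i j : Fin P}
    (hj : (s.contenders v j).Nonempty) :
    ((s.step pick v).pot i : ℝ) ≤ s.pot i - optPot i (s.job j) / 4 := by
  have h1 := s.pot_step pick v i
  have h2 := Finset.single_le_sum
    (f := fun j => if (s.contenders v j).Nonempty then optPot i (s.job j) else 0)
    (fun _ _ => Nat.zero_le _) (Finset.mem_univ j)
  simp only [if_pos hj] at h2
  have h3 : 4 * ((s.step pick v).pot i : ℝ) + optPot i (s.job j) ≤ 4 * s.pot i := by
    exact_mod_cast (Nat.add_le_add_left h2 _).trans h1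
  linarith

theorem pot_eq_sum_helpers {i : Fin P} (hi : s.job i = none) :
    s.pot i = ∑ j ∈ s.helpers i, optPot i (s.job j) := by
  refine (Finset.sum_subset (Finset.subset_univ _) fun j _ hj => ?_).symm
  by_cases hji : j = i
  · simp [hji, hi]
  · rcases hJ : s.job j with _ | J
    · rfl
    · have : J.owner ≠ i := by simpa [helpers, hji, ownerAt, hJ] using hj
      simp [optPot_some, this]

open Classical in
/-- The potential of the work of an owner, weighted by the number of its live steal-backs,
decreases on average. -/
theorem sum_pot_step_le (hl : s.ListsComplete) (he : s.EvenlyDistributed)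
    (pick : Draw P → Fin P → Finset (Fin P) → Fin P) (i : Fin P) :
    ∑ v ∈ Fintype.piFinset s.options,
        Real.exp ((if s.Live v i then (s.ownersLeft.card : ℝ) / P else 0) / 8) *
          (((s.step (pick v) v).pot i : ℝ) + 1) ≤
      (Fintype.piFinset s.options).card * ((s.pot i : ℝ) + 1) := by
  set y : ℝ := (s.ownersLeft.card : ℝ) / P / 8 with hy
  -- This majorant depends on the draw of i alone, so only one coordinate has to be averaged and the
  -- other thieves are irrelevant.
  set f : Option (Fin P) → ℝ := fun x => x.elim ((s.pot i : ℝ) + 1) fun j =>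
    if s.ownerAt j = some i then Real.exp y * ((s.pot i : ℝ) + 1 - optPot i (s.job j) / 4)
    else (s.pot i : ℝ) + 1 with hf
  refine le_trans (Finset.sum_le_sum fun v _ => ?_)
    (sum_piFinset_apply_le s.options i f ((s.pot i : ℝ) + 1) ?_)
  · by_cases hlive : s.Live v i
    · obtain ⟨j, hj, ho⟩ := id hlive
      have hne : (s.contenders v j).Nonempty := ⟨i, by simp [contenders, hj, ho]⟩
      have := s.pot_step_hit_le (pick v) (i := i) hne
      simp only [if_pos hlive, hf, hj, Option.elim_some, if_pos ho, ← hy]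
      exact mul_le_mul_of_nonneg_left (by linarith) (Real.exp_pos _).le
    · have h1 := s.pot_step_le (pick v) v i
      have h2 : f (v i) = (s.pot i : ℝ) + 1 := by
        simp only [hf]
        rcases hv : v i with _ | j
        · rfl
        · have : s.ownerAt j ≠ some i := fun h => hlive ⟨j, hv, h⟩
          simp [this]
      rw [h2]
      simp only [if_neg hlive, zero_div, Real.exp_zero, one_mul]
      linarith
  · by_cases hi : i ∈ s.thieves
    swap
    · simp [options, hi, hf]
    have hnone : s.job i = none := by simpa using (Finset.mem_filter.1 hi).2.2
    have hsub : s.helpers i ⊆ s.candidates i := by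
      unfold candidates
      split_ifs with h
      · exact hl i
      · rw [Finset.not_nonempty_iff_eq_empty] at h
        exact (hl i).trans (h ▸ Finset.empty_subset _)
    have hmem : ∀ j, s.ownerAt j = some i ↔ j ∈ s.helpers i := by
      intro j
      simp only [helpers, Finset.mem_filter, Finset.mem_univ, true_and, iff_and_self]
      rintro h rfl
      simp [ownerAt, hnone] at h
    simp only [options, if_pos hi, Finset.sum_map, Finset.card_map, hf,
      Function.Embedding.some_apply, Option.elim_some, hmem]
    -- Candidates that are not helpers are neutral. Over the helpers the potentials of i's work sum
    -- to exactly φ_i, because i itself is free.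
    rw [← Finset.sum_sdiff hsub, ← Finset.card_sdiff_add_card_eq_card hsub]
    rw [Finset.sum_congr rfl (g := fun _ => (s.pot i : ℝ) + 1)
      fun j hj => if_neg (Finset.mem_sdiff.1 hj).2]
    rw [Finset.sum_congr (s₁ := s.helpers i) rfl fun j hj => if_pos hj]
    rw [← Finset.mul_sum, Finset.sum_sub_distrib, ← Finset.sum_div, ← Nat.cast_sum,
      ← s.pot_eq_sum_helpers hnone]
    simp only [Finset.sum_const, nsmul_eq_mul, Nat.cast_add]
    rw [add_mul]
    refine add_le_add_right ?_ _
    rcases Finset.eq_empty_or_nonempty (s.helpers i) with h0 | h0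
    · simp [s.pot_eq_sum_helpers hnone, h0]
    have hc : (1 : ℝ) ≤ (s.helpers i).card := by exact_mod_cast Finset.card_pos.2 h0
    obtain ⟨j, hj⟩ := h0
    have hown : i ∈ s.ownersLeft := by
      simp only [ownersLeft, Finset.mem_filter, Finset.mem_univ, true_and]
      exact ⟨j, (hmem j).2 hj⟩
    have hpos : (1 : ℝ) ≤ s.pot i := by
      obtain ⟨J, hJ, hJi⟩ := Option.map_eq_some_iff.1 ((hmem j).2 hj)
      have : 0 < s.pot i := by
        refine Finset.sum_pos' (fun _ _ => Nat.zero_le _) ⟨j, Finset.mem_univ _, ?_⟩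
        rw [hJ, optPot_some, if_pos hJi]
        exact J.pot_pos
      exact_mod_cast this
    have hP : (0 : ℝ) < P := Nat.cast_pos.2 (Fin.pos i)
    have hev := he.card_helpers_mul_le hown
    set c : ℝ := ((s.helpers i).card : ℝ)
    have hy8 : y ≤ 1 / (8 * c) := by
      rw [hy, div_div, div_le_div_iff₀ (by positivity) (by positivity)]
      linarith
    -- From c·y ≤ 1/8 and φ_i ≥ 1: c·y·(φ_i + 1) ≤ (φ_i + 1)/8 ≤ φ_i/4.
    have h1 : c * ((s.pot i : ℝ) + 1) - s.pot i / 4 ≤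
        c * ((s.pot i : ℝ) + 1) * (1 - y) := by
      have h2 : y * (8 * c) ≤ 1 := (le_div_iff₀ (by positivity)).1 hy8
      nlinarith [mul_le_mul_of_nonneg_right h2 (show (0 : ℝ) ≤ s.pot i + 1 by positivity)]
    calc _ ≤ Real.exp y * (c * ((s.pot i : ℝ) + 1) * Real.exp (-y)) := by
          refine mul_le_mul_of_nonneg_left (h1.trans ?_) (Real.exp_pos y).le
          exact mul_le_mul_of_nonneg_left (Real.one_sub_le_exp_neg y) (by positivity)
      _ = c * ((s.pot i : ℝ) + 1) * (Real.exp y * Real.exp (-y)) := by ring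
      _ = _ := by rw [← Real.exp_add]; simp

end State


/-! ### Averages over histories. -/

theorem tsum_bind_mul {α β : Type*} (p : PMF α) (f : α → PMF β) (F : β → ℝ≥0∞) :
    ∑' b, p.bind f b * F b = ∑' a, p a * ∑' b, f a b * F b := by
  simp only [PMF.bind_apply, ← ENNReal.tsum_mul_right, ← ENNReal.tsum_mul_left]
  rw [ENNReal.tsum_comm]
  simp only [mul_assoc]

theorem tsum_map_mul {α β : Type*} (p : PMF α) (f : α → β) (F : β → ℝ≥0∞) :
    ∑' b, p.map f b * F b = ∑' a, p a * F (f a) := by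
  rw [PMF.map, tsum_bind_mul]
  refine tsum_congr fun a => ?_
  rw [tsum_eq_single (f a)]
  · simp
  · intro b hb
    simp [PMF.pure_apply, hb]

section Execution

variable {P : ℕ} (rule : ContentionRule P) (tree : Fin P → Option WorkTree)

/-- The histories in which every draw is a possible one. -/
def IsPossible : List (Draw P) → Prop
  | [] => True
  | v :: h => IsPossible h ∧ v ∈ Fintype.piFinset (stateAt rule tree h).options

theorem isPossible_of_mem_support (n : ℕ) {h : List (Draw P)}
    (hh : h ∈ (historyLaw rule tree n).support) : IsPossible rule tree h := by
  induction n generalizing h with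
  | zero =>
    simp only [historyLaw, PMF.support_pure, Set.mem_singleton_iff] at hh
    subst hh
    trivial
  | succ n ih =>
    simp only [historyLaw, PMF.mem_support_bind_iff, PMF.mem_support_map_iff] at hh
    obtain ⟨h', hh', v, hv, rfl⟩ := hh
    refine ⟨ih hh', ?_⟩
    rwa [State.drawLaw, PMF.mem_support_uniformOfFinset_iff] at hv

theorem tsum_drawLaw_mul (s : State P) (F : Draw P → ℝ) (hF : ∀ v, 0 ≤ F v) {c : ℝ}
    (h : ∑ v ∈ Fintype.piFinset s.options, F v ≤ (Fintype.piFinset s.options).card * c) :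
    ∑' v, s.drawLaw v * ENNReal.ofReal (F v) ≤ ENNReal.ofReal c := by
  have hcard : (0 : ℝ) < (Fintype.piFinset s.options).card :=
    Nat.cast_pos.2 (Finset.card_pos.2 s.options_nonempty)
  rw [tsum_eq_sum (s := Fintype.piFinset s.options) fun v hv => by
    rw [State.drawLaw, PMF.uniformOfFinset_apply_of_notMem _ hv, zero_mul]]
  rw [Finset.sum_congr rfl fun v hv => by
    rw [State.drawLaw, PMF.uniformOfFinset_apply_of_mem _ hv], ← Finset.mul_sum,
    ← ENNReal.ofReal_sum_of_nonneg fun v _ => hF v, ← ENNReal.ofReal_natCast,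
    ← ENNReal.ofReal_inv_of_pos hcard, ← ENNReal.ofReal_mul (by positivity)]
  refine ENNReal.ofReal_le_ofReal ?_
  rw [inv_mul_le_iff₀ hcard]
  exact h

/-- A nonnegative function of the history that does not increase on average. -/
theorem tsum_historyLaw_mul_le (F : List (Draw P) → ℝ) (hF : ∀ h, 0 ≤ F h)
    (hstep : ∀ h,
      ∑ v ∈ Fintype.piFinset (stateAt rule tree h).options, F (v :: h) ≤
        (Fintype.piFinset (stateAt rule tree h).options).card * F h) (n : ℕ) :
    ∑' h, historyLaw rule tree n h * ENNReal.ofReal (F h) ≤ ENNReal.ofReal (F []) := by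
  induction n with
  | zero =>
    rw [tsum_eq_single []]
    · simp [historyLaw]
    · intro h hh
      simp [historyLaw, PMF.pure_apply, hh]
  | succ n ih =>
    refine le_trans ?_ ih
    rw [historyLaw, tsum_bind_mul]
    refine ENNReal.tsum_le_tsum fun h => ?_
    by_cases h0 : historyLaw rule tree n h = 0
    · simp [h0]
    · rw [tsum_map_mul]
      gcongr
      exact tsum_drawLaw_mul _ _ (fun v => hF _) (hstep h)

/-! ### Counters and the supermartingale. -/

/-- The number of general steal attempts. -/
def generalCount : List (Draw P) → ℕ
  | [] => 0
  | _ :: h => generalCount h + (stateAt rule tree h).generals.card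

/-- The number of steal-backs whose target holds none of the owner's work. -/
noncomputable def staleCount : List (Draw P) → ℕ
  | [] => 0
  | v :: h => staleCount h + ((stateAt rule tree h).stales v).card

open Classical in
/-- The number of steal-backs of `i` that find work of `i`, as long as the free agents are evenly
distributed. -/
noncomputable def liveCount (i : Fin P) : List (Draw P) → ℕ
  | [] => 0
  | v :: h => liveCount i h +
      if EvenThroughout rule tree h ∧ (stateAt rule tree h).Live v i then 1 else 0

open Classical in
/-- The live steal-backs of `i`, weighted by the fraction of the processors that are owners left. -/
noncomputable def liveWeight (i : Fin P) : List (Draw P) → ℝ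
  | [] => 0
  | v :: h => liveWeight i h +
      if EvenThroughout rule tree h ∧ (stateAt rule tree h).Live v i then
        ((stateAt rule tree h).ownersLeft.card : ℝ) / P else 0

theorem EvenThroughout.head {rule : ContentionRule P} {tree : Fin P → Option WorkTree}
    {h : List (Draw P)} (hh : EvenThroughout rule tree h) :
    (stateAt rule tree h).EvenlyDistributed := by
  cases h with
  | nil => exact hh
  | cons v h => exact hh.2

theorem listsComplete_stateAt (h : List (Draw P)) : (stateAt rule tree h).ListsComplete := by
  induction h with
  | nil =>
    intro i j hj
    simp only [State.helpers, Finset.mem_filter, Finset.mem_univ, true_and, stateAt, State.init,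
      State.ownerAt, Option.map_map] at hj
    obtain ⟨hne, ho⟩ := hj
    obtain ⟨t, -, ht⟩ := Option.map_eq_some_iff.1 ho
    exact absurd ht hne
  | cons v h ih => exact ih.step _ _

/-- The quantity that does not increase on average. -/
noncomputable def supermartingale (h : List (Draw P)) : ℝ :=
  Real.exp (generalCount rule tree h / (16 * P)) * (((stateAt rule tree h).totalPot : ℝ) + 1) +
    ∑ i, Real.exp (liveWeight rule tree i h / 8) * (((stateAt rule tree h).pot i : ℝ) + 1)

theorem supermartingale_nonneg (h : List (Draw P)) : 0 ≤ supermartingale rule tree h := by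
  unfold supermartingale; positivity

/-- The `+ 1` beside the potential keeps the factor at least 1, so the exponential is still visible
after all work is done. -/
theorem exp_generalCount_le (h : List (Draw P)) :
    Real.exp (generalCount rule tree h / (16 * P)) ≤ supermartingale rule tree h := by
  unfold supermartingale
  refine le_add_of_le_of_nonneg ?_ (by positivity)
  exact le_mul_of_one_le_right (Real.exp_pos _).le (le_add_of_nonneg_left (Nat.cast_nonneg _))

theorem exp_liveWeight_le (i : Fin P) (h : List (Draw P)) :
    Real.exp (liveWeight rule tree i h / 8) ≤ supermartingale rule tree h := by
  unfold supermartingale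
  refine le_add_of_nonneg_of_le (by positivity) ?_
  refine le_trans ?_ (Finset.single_le_sum
    (f := fun i => Real.exp (liveWeight rule tree i h / 8) *
      (((stateAt rule tree h).pot i : ℝ) + 1)) (fun _ _ => by positivity) (Finset.mem_univ i))
  exact le_mul_of_one_le_right (Real.exp_pos _).le (le_add_of_nonneg_left (Nat.cast_nonneg _))

theorem sum_supermartingale_le (h : List (Draw P)) :
    ∑ v ∈ Fintype.piFinset (stateAt rule tree h).options, supermartingale rule tree (v :: h) ≤
      (Fintype.piFinset (stateAt rule tree h).options).card * supermartingale rule tree h := by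
  classical
  set s := stateAt rule tree h with hs
  have hstate : ∀ v, stateAt rule tree (v :: h) = s.step (rule.pick h v) v := fun _ => rfl
  simp only [supermartingale, hstate]
  rw [Finset.sum_add_distrib, mul_add, Finset.sum_comm, Finset.mul_sum]
  refine add_le_add ?_ (Finset.sum_le_sum fun i _ => ?_)
  · have h1 := s.sum_totalPot_step_le (rule.pick h)
    have h2 := mul_le_mul_of_nonneg_left h1
      (Real.exp_pos ((generalCount rule tree h : ℝ) / (16 * P))).le
    rw [Finset.mul_sum] at h2
    refine le_trans (Finset.sum_le_sum fun v _ => le_of_eq ?_) (h2.trans_eq (by rw [← hs]; ring))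
    rw [← mul_assoc, ← Real.exp_add]
    simp only [generalCount, Nat.cast_add, add_div, ← hs]
  · by_cases he : EvenThroughout rule tree h
    · have h1 := s.sum_pot_step_le (listsComplete_stateAt rule tree h) he.head (rule.pick h) i
      have h2 := mul_le_mul_of_nonneg_left h1 (Real.exp_pos (liveWeight rule tree i h / 8)).le
      rw [Finset.mul_sum] at h2
      refine le_trans (Finset.sum_le_sum fun v _ => le_of_eq ?_) (h2.trans_eq (by rw [← hs]; ring))
      rw [← mul_assoc, ← Real.exp_add]
      simp only [liveWeight, he, true_and, add_div, ← hs]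
    -- Once even distribution has failed, the live weight is frozen and the potential still cannot
    -- grow.
    · rw [← nsmul_eq_mul]
      refine Finset.sum_le_card_nsmul _ _ _ fun v _ => ?_
      simp only [liveWeight, he, false_and, if_false, add_zero]
      have := s.pot_step_le (rule.pick h v) v i
      gcongr

/-- The initial potential of the work of a processor is exponential in the span. -/
theorem pot_init_le (i : Fin P) : (State.init tree).pot i ≤ 9 ^ span tree := by
  rw [State.pot, Finset.sum_eq_single i]
  · simp only [State.init]
    rcases ht : tree i with _ | t
    · simp
    · simp only [Option.map_some, optPot_some, if_true, Job.pot, dequePot, add_zero]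
      refine Nat.pow_le_pow_right (by norm_num) ?_
      have h1 := Finset.le_sup (f := fun i => ((tree i).map WorkTree.height).getD 0)
        (Finset.mem_univ i)
      have h2 := Finset.le_sup (f := fun i => ((tree i).map WorkTree.maxSize).getD 0)
        (Finset.mem_univ i)
      have h3 := t.depth_le
      simp only [ht, Option.map_some, Option.getD_some] at h1 h2
      unfold span
      omega
  · intro j _ hj
    simp only [State.init]
    rcases tree j with _ | t
    · simp
    · simp [optPot_some, hj]
  · simp

theorem supermartingale_nil_le (hP : 1 ≤ P) :
    supermartingale rule tree [] ≤ 4 * P * 9 ^ span tree := by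
  have h1 : ∀ i, ((State.init tree).pot i : ℝ) ≤ 9 ^ span tree := fun i => by
    exact_mod_cast pot_init_le tree i
  have h2 : ((State.init tree).totalPot : ℝ) ≤ P * 9 ^ span tree := by
    rw [State.totalPot, Nat.cast_sum]
    refine (Finset.sum_le_card_nsmul _ _ _ fun i _ => h1 i).trans_eq ?_
    simp
  have h3 : ∑ i, (((State.init tree).pot i : ℝ) + 1) ≤ P * (9 ^ span tree + 1) := by
    refine (Finset.sum_le_card_nsmul _ _ (9 ^ span tree + 1) fun i _ => ?_).trans_eq ?_
    · linarith [h1 i]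
    · simp [mul_add]
  have h4 : (1 : ℝ) ≤ 9 ^ span tree := one_le_pow₀ (by norm_num)
  have h5 : (1 : ℝ) ≤ P := by exact_mod_cast hP
  simp only [supermartingale, generalCount, liveWeight, stateAt, Nat.cast_zero, zero_div,
    Real.exp_zero, one_mul]
  nlinarith

theorem tsum_supermartingale_le (hP : 1 ≤ P) (n : ℕ) :
    ∑' h, historyLaw rule tree n h * ENNReal.ofReal (supermartingale rule tree h) ≤
      ENNReal.ofReal (4 * P * 9 ^ span tree) :=
  (tsum_historyLaw_mul_le rule tree _ (supermartingale_nonneg rule tree)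
    (sum_supermartingale_le rule tree) n).trans
      (ENNReal.ofReal_le_ofReal (supermartingale_nil_le rule tree hP))

/-! ### Pathwise accounting of steal attempts. -/

theorem card_lists_add_staleCount_le {h : List (Draw P)} (hh : IsPossible rule tree h) :
    ∑ i, ((stateAt rule tree h).list i).card + staleCount rule tree h ≤
      generalCount rule tree h := by
  induction h with
  | nil => simp [stateAt, State.init, staleCount, generalCount]
  | cons v h ih =>
    have h1 := ih hh.1
    have h2 := (stateAt rule tree h).card_lists_step (rule.pick h v) hh.2
    simp only [stateAt, staleCount, generalCount] at h1 h2 ⊢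
    omega

theorem stealAttemptsWhileEven_le (h : List (Draw P)) :
    stealAttemptsWhileEven rule tree h ≤ generalCount rule tree h + staleCount rule tree h +
      ∑ i, liveCount rule tree i h := by
  classical
  induction h with
  | nil => simp [stealAttemptsWhileEven]
  | cons v h ih =>
    have h1 := (stateAt rule tree h).card_thieves_le v
    simp only [stealAttemptsWhileEven, generalCount, staleCount, liveCount, Finset.sum_add_distrib]
    by_cases he : EvenThroughout rule tree h
    · simp only [he, if_true, true_and, Finset.sum_boole, Nat.cast_id]
      omega
    · simp only [he, if_false, false_and, Finset.sum_const_zero]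
      omega

theorem liveWeight_le_cons (i : Fin P) (v : Draw P) (h : List (Draw P)) :
    liveWeight rule tree i h ≤ liveWeight rule tree i (v :: h) := by
  rw [liveWeight]
  refine le_add_of_nonneg_right ?_
  split_ifs <;> positivity

theorem liveCount_cons_of_notMem {i : Fin P} {h : List (Draw P)}
    (hi : i ∉ (stateAt rule tree h).ownersLeft) (v : Draw P) :
    liveCount rule tree i (v :: h) = liveCount rule tree i h := by
  rw [liveCount, if_neg, add_zero]
  rintro ⟨-, j, -, hj⟩
  refine hi ?_
  simp only [State.ownersLeft, Finset.mem_filter, Finset.mem_univ, true_and]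
  exact ⟨j, hj⟩

/-- As long as an owner is left, its live steal-backs have at least the current weight. -/
theorem card_mul_liveCount_cons_le {i : Fin P} {h : List (Draw P)}
    (hh : ((stateAt rule tree h).ownersLeft.card : ℝ) * liveCount rule tree i h ≤
      P * liveWeight rule tree i h) (v : Draw P) :
    ((stateAt rule tree h).ownersLeft.card : ℝ) * liveCount rule tree i (v :: h) ≤
      P * liveWeight rule tree i (v :: h) := by
  have hP : (P : ℝ) ≠ 0 := Nat.cast_ne_zero.2 (Fin.pos i).ne'
  simp only [liveCount, liveWeight]
  split_ifs
  · rw [Nat.cast_add, mul_add, mul_add, mul_div_cancel₀ _ hP]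
    simpa using hh
  · simpa using hh

theorem card_mul_liveCount_le {i : Fin P} (h : List (Draw P)) :
    ((stateAt rule tree h).ownersLeft.card : ℝ) * liveCount rule tree i h ≤
      P * liveWeight rule tree i h := by
  induction h with
  | nil => simp [liveCount, liveWeight]
  | cons v h ih =>
    refine le_trans ?_ (card_mul_liveCount_cons_le rule tree ih v)
    refine mul_le_mul_of_nonneg_right ?_ (Nat.cast_nonneg _)
    exact_mod_cast Finset.card_le_card ((stateAt rule tree h).ownersLeft_step (rule.pick h v) v)

/-- Each 1/m with k' < m ≤ k is at least 1/k. The range form is needed because several owners may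
finish in the same timestep. -/
theorem sub_div_le_harmonic_sub {k' k : ℕ} (h : k' ≤ k) :
    ((k : ℝ) - k') / k ≤ (harmonic k : ℝ) - harmonic k' := by
  induction k, h using Nat.le_induction with
  | base => simp
  | succ k hk ih =>
    rw [harmonic_succ]
    push_cast
    have hk' : (k' : ℝ) ≤ k := by exact_mod_cast hk
    have h1 : ((k : ℝ) - k') / (k + 1) ≤ (k - k') / k := by
      rcases Nat.eq_zero_or_pos k with rfl | hk0
      · have : k' = 0 := by omega
        simp [this]
      · have : (0 : ℝ) < k := Nat.cast_pos.2 hk0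
        exact div_le_div_of_nonneg_left (sub_nonneg.2 hk') this (by linarith)
    have h2 : ((k : ℝ) + 1 - k') / (k + 1) = (k - k') / (k + 1) + (k + 1 : ℝ)⁻¹ := by
      field_simp; ring
    rw [h2]
    linarith

/-- The owners that finish first may have made few live steal-backs only. -/
theorem sum_liveCount_finished_le (h : List (Draw P)) {R : ℝ}
    (hR : ∀ i, liveWeight rule tree i h ≤ R) (hR0 : 0 ≤ R) :
    ∑ i ∈ (stateAt rule tree h).ownersLeftᶜ, (liveCount rule tree i h : ℝ) ≤
      P * R * ((harmonic P : ℝ) - harmonic (stateAt rule tree h).ownersLeft.card) := by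
  induction h with
  | nil =>
    have h1 : (stateAt rule tree []).ownersLeft.card ≤ P :=
      (Finset.card_le_univ _).trans_eq (Fintype.card_fin P)
    have h2 := sub_div_le_harmonic_sub h1
    have h3 : (0 : ℝ) ≤ (P - (stateAt rule tree []).ownersLeft.card) / P :=
      div_nonneg (sub_nonneg.2 (by exact_mod_cast h1)) (Nat.cast_nonneg _)
    simp only [liveCount, Nat.cast_zero, Finset.sum_const_zero]
    exact mul_nonneg (by positivity) (h3.trans h2)
  | cons v h ih =>
    have hR' : ∀ i, liveWeight rule tree i h ≤ R := fun i =>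
      (liveWeight_le_cons rule tree i v h).trans (hR i)
    have ih := ih hR'
    set O := (stateAt rule tree h).ownersLeft with hO
    set O' := (stateAt rule tree (v :: h)).ownersLeft with hO'
    have hsub : O' ⊆ O := (stateAt rule tree h).ownersLeft_step (rule.pick h v) v
    have hsplit : O'ᶜ = Oᶜ ∪ (O \ O') := by
      ext i
      have := @hsub i
      simp only [Finset.mem_compl, Finset.mem_union, Finset.mem_sdiff]
      tauto
    have hdisj : Disjoint Oᶜ (O \ O') :=
      Finset.disjoint_left.2 fun i hi hi' =>
        Finset.mem_compl.1 hi (Finset.mem_sdiff.1 hi').1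
    rw [hsplit, Finset.sum_union hdisj]
    have h1 : ∑ i ∈ Oᶜ, (liveCount rule tree i (v :: h) : ℝ) =
        ∑ i ∈ Oᶜ, (liveCount rule tree i h : ℝ) :=
      Finset.sum_congr rfl fun i hi => by
        rw [liveCount_cons_of_notMem rule tree (Finset.mem_compl.1 hi)]
    -- An owner finishing now made all its live steal-backs with at least `O.card` owners left, each
    -- of weight at least `O.card / P`. The total weight R thus allows at most P·R/`O.card` of them.
    have h2 : ∑ i ∈ O \ O', (liveCount rule tree i (v :: h) : ℝ) ≤
        ((O.card : ℝ) - O'.card) * (P * R / O.card) := by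
      refine (Finset.sum_le_card_nsmul _ _ (P * R / O.card) fun i hi => ?_).trans_eq ?_
      · have hpos : (0 : ℝ) < O.card :=
          Nat.cast_pos.2 (Finset.card_pos.2 ⟨i, (Finset.mem_sdiff.1 hi).1⟩)
        have h3 := card_mul_liveCount_cons_le rule tree (card_mul_liveCount_le (i := i) rule tree h) v
        rw [le_div_iff₀ hpos, mul_comm]
        exact h3.trans (mul_le_mul_of_nonneg_left (hR i) (Nat.cast_nonneg _))
      · rw [nsmul_eq_mul, Finset.card_sdiff_of_subset hsub, Nat.cast_sub (Finset.card_le_card hsub)]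
    have h3 := mul_le_mul_of_nonneg_left (sub_div_le_harmonic_sub (Finset.card_le_card hsub))
      (mul_nonneg (Nat.cast_nonneg P) hR0)
    have h4 : ((O.card : ℝ) - O'.card) * (P * R / O.card) =
      P * R * (((O.card : ℝ) - O'.card) / O.card) := by ring
    rw [h1]
    linarith

/-- Each of the k owners still left has made at most P·R/k live steal-backs, together at most P·R ≤
P·R·H_k if k > 0. This complements the P·R·(H_P - H_k) of the finished owners. -/
theorem sum_liveCount_le (h : List (Draw P)) {R : ℝ}
    (hR : ∀ i, liveWeight rule tree i h ≤ R) (hR0 : 0 ≤ R) :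
    ∑ i, (liveCount rule tree i h : ℝ) ≤ P * R * harmonic P := by
  have h1 := sum_liveCount_finished_le rule tree h hR hR0
  set O := (stateAt rule tree h).ownersLeft with hO
  have hPR : 0 ≤ P * R := mul_nonneg (Nat.cast_nonneg P) hR0
  have h2 : ∑ i ∈ O, (liveCount rule tree i h : ℝ) ≤ P * R * ((O.card : ℝ) / O.card) := by
    refine (Finset.sum_le_card_nsmul _ _ (P * R / O.card) fun i hi => ?_).trans_eq ?_
    · have hpos : (0 : ℝ) < O.card := Nat.cast_pos.2 (Finset.card_pos.2 ⟨i, hi⟩)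
      rw [le_div_iff₀ hpos, mul_comm]
      exact (card_mul_liveCount_le rule tree h).trans
        (mul_le_mul_of_nonneg_left (hR i) (Nat.cast_nonneg _))
    · rw [nsmul_eq_mul]; ring
  have h3 := mul_le_mul_of_nonneg_left (sub_div_le_harmonic_sub (Nat.zero_le O.card)) hPR
  simp only [Nat.cast_zero, sub_zero, harmonic_zero, Rat.cast_zero] at h3
  rw [← Finset.sum_add_sum_compl O]
  linarith

theorem thieves_eq_empty_of_le_one (s : State P) (hP : P ≤ 1) : s.thieves = ∅ := by
  have : Subsingleton (Fin P) := Fin.subsingleton_iff_le_one.2 hP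
  refine Finset.filter_eq_empty_iff.2 ?_
  rintro i - ⟨⟨j, hj⟩, hi⟩
  rw [Subsingleton.elim j i] at hj
  simp only [State.busy, Finset.mem_filter, Finset.mem_univ, true_and] at hj
  simp [Option.isNone_iff_eq_none.1 hi] at hj

theorem stealAttemptsWhileEven_eq_zero (hP : P ≤ 1) (h : List (Draw P)) :
    stealAttemptsWhileEven rule tree h = 0 := by
  induction h with
  | nil => rfl
  | cons v h ih => simp [stealAttemptsWhileEven, ih, thieves_eq_empty_of_le_one _ hP]

theorem one_le_logb_of_two_le {x : ℝ} (hx : 2 ≤ x) : 1 ≤ Real.logb 2 x := by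
  rw [Real.le_logb_iff_rpow_le (by norm_num) (by linarith)]
  simpa using hx

theorem log_le_logb {x : ℝ} (hx : 1 ≤ x) : Real.log x ≤ Real.logb 2 x := by
  rw [Real.logb, le_div_iff₀ (Real.log_pos (by norm_num))]
  exact mul_le_of_le_one_right (Real.log_nonneg hx) (by linarith [Real.log_two_lt_d9])

/-- The number of steal attempts is controlled by the logarithm of the supermartingale. -/
theorem stealAttemptsWhileEven_le_log (hP : 2 ≤ P) {h : List (Draw P)}
    (hh : IsPossible rule tree h) : (stealAttemptsWhileEven rule tree h : ℝ) ≤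
      48 * (P * Real.logb 2 P) * Real.log (supermartingale rule tree h) := by
  set Y := supermartingale rule tree h
  have hP2 : (2 : ℝ) ≤ P := by exact_mod_cast hP
  have hY : 0 < Y := (Real.exp_pos _).trans_le (exp_generalCount_le rule tree h)
  have hG : (generalCount rule tree h : ℝ) ≤ 16 * P * Real.log Y := by
    have := (Real.le_log_iff_exp_le hY).2 (exp_generalCount_le rule tree h)
    rw [div_le_iff₀ (by positivity)] at this
    linarith
  have hW : ∀ i, liveWeight rule tree i h ≤ 8 * Real.log Y := fun i => by
    have := (Real.le_log_iff_exp_le hY).2 (exp_liveWeight_le rule tree i h)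
    linarith
  have hlog : 0 ≤ Real.log Y := Real.log_nonneg
    (le_trans (Real.one_le_exp (by positivity)) (exp_generalCount_le rule tree h))
  have hL := sum_liveCount_le rule tree h hW (by positivity)
  have hS := card_lists_add_staleCount_le rule tree hh
  have hN : (stealAttemptsWhileEven rule tree h : ℝ) ≤
      2 * generalCount rule tree h + ∑ i, (liveCount rule tree i h : ℝ) := by
    have h1 := stealAttemptsWhileEven_le rule tree h
    exact_mod_cast h1.trans (by omega : _ ≤ 2 * generalCount rule tree h +
      ∑ i, liveCount rule tree i h)
  have hlg := one_le_logb_of_two_le hP2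
  have hH : (harmonic P : ℝ) ≤ 2 * Real.logb 2 P := by
    have h1 := harmonic_le_one_add_log P
    have h2 := log_le_logb (show (1 : ℝ) ≤ P by linarith)
    linarith
  have hPY : 0 ≤ P * Real.log Y := by positivity
  -- The constant is 48 = 2·16 + 8·2: general and stale attempts give 32 P log Y, live ones 8 P H_P
  -- log Y with H_P ≤ 2 lg P.
  nlinarith [mul_le_mul_of_nonneg_left hH hPY, mul_le_mul_of_nonneg_left hlg hPY]

end Execution

/-! ### Tail and expectation bounds. -/

theorem logb_le_span {P : ℕ} (tree : Fin P → Option WorkTree) :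
    Real.logb 2 P ≤ span tree := by
  have h1 := Nat.le_ceil (Real.logb 2 P)
  have h2 := Real.natCeil_logb_natCast 2 P
  rw [Nat.cast_ofNat] at h2
  rw [h2] at h1
  refine h1.trans ?_
  unfold span
  exact_mod_cast (by omega)


theorem log_nine_le : Real.log 9 ≤ 3 := by
  have h1 : Real.log 9 ≤ Real.log (2 ^ 4) := Real.log_le_log (by norm_num) (by norm_num)
  rw [Real.log_pow] at h1
  push_cast at h1
  linarith [Real.log_two_lt_d9]

theorem log_four_le : Real.log 4 ≤ 2 := by
  have h1 : Real.log 4 = Real.log (2 ^ 2) := by norm_num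
  rw [Real.log_pow] at h1
  push_cast at h1
  linarith [Real.log_two_lt_d9]

section Execution

variable {P : ℕ} (rule : ContentionRule P) (tree : Fin P → Option WorkTree)

theorem log_initial_bound_le {x : ℝ} (hx : 2 ≤ x) (T : ℕ) :
    Real.log (4 * x * 9 ^ T) ≤ 2 + Real.logb 2 x + 3 * T := by
  rw [Real.log_mul (by positivity) (by positivity), Real.log_mul (by norm_num) (by positivity),
    Real.log_pow]
  have h1 := log_le_logb (show 1 ≤ x by linarith)
  have h2 := mul_le_mul_of_nonneg_left log_nine_le (Nat.cast_nonneg (α := ℝ) T)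
  linarith [log_four_le]

/-- The tail bound. -/
theorem tail_stealAttemptsWhileEven (hP : 1 ≤ P) {ε : ℝ} (hε : 0 < ε) (hε1 : ε ≤ 1) (n : ℕ) :
    ENNReal.ofReal (1 - ε) ≤ (historyLaw rule tree n).toOuterMeasure
      {h | (stealAttemptsWhileEven rule tree h : ℝ) ≤
        400 * (P * Real.logb 2 P * (span tree + Real.logb 2 (P / ε)))} := by
  set S := {h : List (Draw P) | (stealAttemptsWhileEven rule tree h : ℝ) ≤
    400 * (P * Real.logb 2 P * (span tree + Real.logb 2 (P / ε)))} with hS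
  set p := historyLaw rule tree n
  set m : ℝ := 4 * P * 9 ^ span tree with hm
  have hP0 : (1 : ℝ) ≤ P := by exact_mod_cast hP
  have hm0 : 0 < m := by positivity
  have hout : ∀ h, IsPossible rule tree h → h ∉ S →
      1 ≤ ENNReal.ofReal (ε / m) * ENNReal.ofReal (supermartingale rule tree h) := by
    intro h hh hhS
    rw [← ENNReal.ofReal_mul (by positivity), ENNReal.one_le_ofReal]
    by_contra! hlt
    apply hhS
    simp only [hS, Set.mem_ofPred_eq]
    -- For P = 1 the claimed bound is 0, as lg 1 = 0; a lone processor never steals.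
    rcases Nat.lt_or_ge P 2 with hP2 | hP2
    · obtain rfl : P = 1 := by omega
      simp [stealAttemptsWhileEven_eq_zero rule tree le_rfl]
    have hP2' : (2 : ℝ) ≤ P := by exact_mod_cast hP2
    have hx : 2 ≤ (P : ℝ) / ε := by
      rw [le_div_iff₀ hε]; nlinarith
    have hY : 0 < supermartingale rule tree h :=
      (Real.exp_pos _).trans_le (exp_generalCount_le rule tree h)
    have h1 : Real.log (supermartingale rule tree h) ≤
        Real.log (4 * (P / ε) * 9 ^ span tree) := by
      refine Real.log_le_log hY ?_
      have : 4 * ((P : ℝ) / ε) * 9 ^ span tree = m / ε := by rw [hm]; ring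
      rw [this, le_div_iff₀ hε]
      rw [div_mul_eq_mul_div, div_lt_one hm0] at hlt
      linarith
    have h2 := log_initial_bound_le hx (span tree)
    have h3 := one_le_logb_of_two_le hx
    have h4 := one_le_logb_of_two_le hP2'
    refine (stealAttemptsWhileEven_le_log rule tree hP2 hh).trans ?_
    rw [← mul_assoc 400, show (400 : ℝ) * (P * Real.logb 2 P) * (span tree + Real.logb 2 (P / ε)) =
      48 * (P * Real.logb 2 P) * (400 / 48 * (span tree + Real.logb 2 (P / ε))) by ring]
    refine mul_le_mul_of_nonneg_left ?_ (by positivity)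
    have h5 : (0 : ℝ) ≤ span tree := Nat.cast_nonneg _
    linarith
  have key : (1 : ℝ≥0∞) ≤ p.toOuterMeasure S + ENNReal.ofReal ε := by
    calc (1 : ℝ≥0∞) = ∑' h, p h := p.tsum_coe.symm
      -- Markov's inequality in pointwise form: outside S the supermartingale is at least m/ε.
      _ ≤ ∑' h, (S.indicator p h + ENNReal.ofReal (ε / m) *
            (p h * ENNReal.ofReal (supermartingale rule tree h))) := by
          refine ENNReal.tsum_le_tsum fun h => ?_
          by_cases hh : h ∈ S
          · rw [Set.indicator_of_mem hh]
            exact le_self_add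
          · by_cases h0 : p h = 0
            · simp [h0]
            · have h1 := hout h (isPossible_of_mem_support rule tree n
                ((PMF.mem_support_iff _ _).2 h0)) hh
              refine le_trans ?_ le_add_self
              rw [mul_left_comm]
              exact le_mul_of_one_le_right' h1
      _ ≤ p.toOuterMeasure S + ENNReal.ofReal (ε / m) * ENNReal.ofReal m := by
          rw [ENNReal.tsum_add, ENNReal.tsum_mul_left, PMF.toOuterMeasure_apply]
          gcongr
          exact tsum_supermartingale_le rule tree hP n
      _ = _ := by
          rw [← ENNReal.ofReal_mul (by positivity), div_mul_cancel₀ _ hm0.ne']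
  rw [ENNReal.ofReal_sub _ hε.le, ENNReal.ofReal_one]
  exact tsub_le_iff_right.2 key

/-- The bound on the expectation. -/
theorem expectation_stealAttemptsWhileEven (hP : 1 ≤ P) (n : ℕ) :
    ∑' h, historyLaw rule tree n h * (stealAttemptsWhileEven rule tree h : ℝ≥0∞) ≤
      ENNReal.ofReal (400 * (P * Real.logb 2 P * span tree)) := by
  rcases Nat.lt_or_ge P 2 with hP2 | hP2
  · simp [stealAttemptsWhileEven_eq_zero rule tree (show P ≤ 1 by omega)]
  set p := historyLaw rule tree n
  set m : ℝ := 4 * P * 9 ^ span tree with hm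
  set A : ℝ := 48 * (P * Real.logb 2 P) with hA
  have hP2' : (2 : ℝ) ≤ P := by exact_mod_cast hP2
  have hm0 : 0 < m := by positivity
  have hm1 : 1 ≤ m := by
    have : (1 : ℝ) ≤ 9 ^ span tree := one_le_pow₀ (by norm_num)
    nlinarith
  have hlg := one_le_logb_of_two_le hP2'
  have hA0 : 0 ≤ A := by positivity
  have hlog : 0 ≤ Real.log m := Real.log_nonneg hm1
  have hbound : ∀ h, IsPossible rule tree h → (stealAttemptsWhileEven rule tree h : ℝ≥0∞) ≤
      ENNReal.ofReal (A * Real.log m) +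
        ENNReal.ofReal (A / m) * ENNReal.ofReal (supermartingale rule tree h) := by
    intro h hh
    have hY : 0 < supermartingale rule tree h :=
      (Real.exp_pos _).trans_le (exp_generalCount_le rule tree h)
    rw [← ENNReal.ofReal_mul (by positivity), ← ENNReal.ofReal_add (by positivity) (by positivity),
      ← ENNReal.ofReal_natCast]
    refine ENNReal.ofReal_le_ofReal ((stealAttemptsWhileEven_le_log rule tree hP2 hh).trans ?_)
    -- The tangent of log at m replaces Jensen's inequality: log Y ≤ log m + Y/m - 1, and Y/m has
    -- mean at most 1.
    have h1 := Real.log_le_sub_one_of_pos (div_pos hY hm0)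
    rw [Real.log_div hY.ne' hm0.ne'] at h1
    calc A * Real.log (supermartingale rule tree h)
        ≤ A * (Real.log m + supermartingale rule tree h / m) :=
          mul_le_mul_of_nonneg_left (by linarith) hA0
      _ = _ := by ring
  calc ∑' h, p h * (stealAttemptsWhileEven rule tree h : ℝ≥0∞)
      ≤ ∑' h, (p h * ENNReal.ofReal (A * Real.log m) + ENNReal.ofReal (A / m) *
          (p h * ENNReal.ofReal (supermartingale rule tree h))) := by
        refine ENNReal.tsum_le_tsum fun h => ?_
        by_cases h0 : p h = 0
        · simp [h0]
        · rw [mul_left_comm, ← mul_add]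
          gcongr
          exact hbound h (isPossible_of_mem_support rule tree n ((PMF.mem_support_iff _ _).2 h0))
    _ ≤ ENNReal.ofReal (A * Real.log m) + ENNReal.ofReal (A / m) * ENNReal.ofReal m := by
        rw [ENNReal.tsum_add, ENNReal.tsum_mul_left, ENNReal.tsum_mul_right, p.tsum_coe, one_mul]
        gcongr
        exact tsum_supermartingale_le rule tree hP n
    _ ≤ _ := by
        rw [← ENNReal.ofReal_mul (by positivity), ← ENNReal.ofReal_add (by positivity)
          (by positivity), div_mul_cancel₀ _ hm0.ne']
        refine ENNReal.ofReal_le_ofReal ?_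
        -- The span contains ⌈lg P⌉ ≥ 1, so it absorbs both lg P and the additive constants; hence
        -- no separate lg P term in the expectation.
        have h1 := log_initial_bound_le hP2' (span tree)
        have h2 := logb_le_span tree
        rw [← hm] at h1
        have h3 : A * Real.log m + A = A * (Real.log m + 1) := by ring
        rw [h3, show 400 * (P * Real.logb 2 P * span tree) = A * (400 / 48 * span tree) by
          rw [hA]; ring]
        exact mul_le_mul_of_nonneg_left (by linarith) hA0

end Execution

end LocalizedStealing

theorem theorem1 :
    ∃ C : ℝ, 0 < C ∧
      ∀ (P : ℕ) (_ : 1 ≤ P)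
        (tree : Fin P → Option LocalizedStealing.WorkTree)
        (_ : ∀ i, ∀ t ∈ tree i, t.PosSizes ∧ t.Balanced)
        (rule : LocalizedStealing.ContentionRule P),
        (∀ ε : ℝ, 0 < ε → ε ≤ 1 → ∀ n : ℕ,
          ENNReal.ofReal (1 - ε) ≤
            (LocalizedStealing.historyLaw rule tree n).toOuterMeasure
              {h | (LocalizedStealing.stealAttemptsWhileEven rule tree h : ℝ) ≤
                C * (P * Real.logb 2 P *
                  (LocalizedStealing.span tree + Real.logb 2 (P / ε)))}) ∧
        (∀ n : ℕ,
          ∑' h, LocalizedStealing.historyLaw rule tree n h *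
              (LocalizedStealing.stealAttemptsWhileEven rule tree h : ENNReal) ≤
            ENNReal.ofReal (C * (P * Real.logb 2 P * LocalizedStealing.span tree))) ∧
        ((∀ n : ℕ, ∀ h ∈ (LocalizedStealing.historyLaw rule tree n).support,
            LocalizedStealing.EvenThroughout rule tree h) →
          (∀ ε : ℝ, 0 < ε → ε ≤ 1 → ∀ n : ℕ,
            ENNReal.ofReal (1 - ε) ≤
              (LocalizedStealing.historyLaw rule tree n).toOuterMeasure
                {h | (LocalizedStealing.stealAttempts rule tree h : ℝ) ≤
                  C * (P * Real.logb 2 P *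
                    (LocalizedStealing.span tree + Real.logb 2 (P / ε)))}) ∧
          (∀ n : ℕ,
            ∑' h, LocalizedStealing.historyLaw rule tree n h *
                (LocalizedStealing.stealAttempts rule tree h : ENNReal) ≤
              ENNReal.ofReal (C * (P * Real.logb 2 P * LocalizedStealing.span tree)))) := by
  refine ⟨400, by norm_num, fun P hP tree _ rule => ?_⟩
  have tail := fun ε (h0 : 0 < ε) (h1 : ε ≤ 1) n =>
    LocalizedStealing.tail_stealAttemptsWhileEven rule tree hP h0 h1 n
  have expectation := LocalizedStealing.expectation_stealAttemptsWhileEven rule tree hP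
  refine ⟨tail, expectation, fun heven => ?_⟩
  have heq : ∀ n, ∀ h ∈ (LocalizedStealing.historyLaw rule tree n).support,
      LocalizedStealing.stealAttemptsWhileEven rule tree h =
        LocalizedStealing.stealAttempts rule tree h := fun n h hh =>
    LocalizedStealing.stealAttemptsWhileEven_eq rule tree h (heven n h hh)
  refine ⟨fun ε h0 h1 n => (tail ε h0 h1 n).trans (PMF.toOuterMeasure_mono _ ?_), fun n =>
    le_of_eq_of_le (tsum_congr fun h => ?_) (expectation n)⟩
  · rintro h ⟨hh, hs⟩
    rw [Set.mem_ofPred_eq] at hh ⊢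
    rwa [← heq n h hs]
  · by_cases hs : LocalizedStealing.historyLaw rule tree n h = 0
    · rw [hs, zero_mul, zero_mul]
    · rw [heq n h ((PMF.mem_support_iff _ _).2 hs)]
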